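/- **Setting.** A locale is given by a frame together with a basis: a *basis* of a frame $L$ is a set $B_L\subseteq L$ with $x=\bigvee\{b\in B_L: b\le x\}$ for all $x\in L$. A continuous map $f:L\to M$ is given by a frame homomorphism $f^-:M\to L$. Write $x^*$ for the pseudocomplement of $x$, and $x\prec y$ for $x^*\vee y=1$. A locale with basis $B$ is *compact* if every $U\subseteq B$ with $\bigvee U=1$ has a finite subset with join $1$, and *regular* if $a=\bigvee\{b\in B: b\prec a\}$ for all $a\in B$. A *compactification* (compact regular compactification) of $L$ is a continuous map $k:L\to kL$ with $kL$ compact and regular that is dense ($k^-(a)=0$ implies $a=0$) and an embedding ($k^-$ is onto). A *pcd-lattice* is a pseudocomplemented distributive lattice (with $0$ and $1$); a *sub-pcd-lattice* of a frame is a subset closed under finite meets, finite joins and the pseudocomplement of the frame. A *strong inclusion* on a pcd-lattice $P$ is a binary relation $\lhd$ on $P$ such that 1. $0\lhd 0$ and $1\lhd 1$; 2. $x\le a\lhd b\le y$ implies $x\lhd y$; 3. $x\lhd a$ and $x\lhd b$ imply $x\lhd a\wedge b$; 4. $x\lhd a$ and $y\lhd a$ imply $x\vee y\lhd a$; 5.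 $a\lhd b$ implies $b^*\lhd a^*$; 6. $a\lhd b$ implies $a\prec b$; 7. $x\lhd y$ implies $x\lhd z\lhd y$ for some $z\in P$. If $P$ is a sub-pcd-lattice of $L$, then $\lhd$ is *compatible* with $L$ if $P$ is a basis of $L$ and $a=\bigvee_L\{x\in P: x\lhd a\}$ for all $a\in P$. A *round ideal* of $(P,\lhd)$ is an ideal $I$ of $P$ such that for every $b\in I$ there is $a\in I$ with $b\lhd a$; $\mathcal R(P,\lhd)$ is the set of round ideals ordered by inclusion. **Theorem.** Let $k:L\to kL$ be a compactification of a locale $L$. Then there are a sub-pcd-lattice $P_k$ of $L$ and a compatible strong inclusion $\lhd_k$ on $P_k$ such that $\mathcal R(P_k,\lhd_k)$ is isomorphic to $kL$. Explicitly, $kL$ has a basis $B$ that is also a sub-pcd-lattice of $kL$ (small, relative to a given universe, if the given basis of $kL$ is small), and for every such $B$ the following may be taken: $P_k$ is the sub-pcd-lattice of $L$ generated by $\{k^-(b): b\in B\}$ (again small), and $\lhd_k$ is the least relation on $P_k$ that contains all pairs $(k^-(b),k^-(a))$ with $a,b\in B$ and $b\prec a$ and is closed under conditions 1–5. Moreover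 there is an isomorphism $e:\mathcal R(P_k,\lhd_k)\to kL$ over $L$, that is, with $k^-(e(I))=\bigvee_L I$ for all $I\in\mathcal R(P_k,\lhd_k)$. -/

import Mathlib

universe u v w

/-! ### Pseudocomplemented distributive lattices -/

/-- A pseudocomplemented distributive lattice (pcd-lattice): a bounded distributive lattice in which
every `b` has a pseudocomplement `bᶜ`, the largest element whose meet with `b` is `⊥`. -/
class PCDLattice (P : Type u) extends DistribLattice P, BoundedOrder P, Compl P where
  le_compl_iff : ∀ a b : P, a ≤ bᶜ ↔ a ⊓ b = ⊥

/-- The well inside relation: `x` is well inside `y` iff `x* ∨ y = 1`. -/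
def WellInside {P : Type u} [Lattice P] [BoundedOrder P] [Compl P] (x y : P) : Prop :=
  xᶜ ⊔ y = ⊤

/-- A sub-pcd-lattice of a frame: a subset closed under finite meets and joins (including the empty
ones) and under the pseudocomplement of the frame. -/
structure SubPCDLattice (L : Type u) [Order.Frame L] extends Sublattice L where
  bot_mem' : ⊥ ∈ carrier
  top_mem' : ⊤ ∈ carrier
  compl_mem' : ∀ {a : L}, a ∈ carrier → aᶜ ∈ carrier

namespace SubPCDLattice

variable {L : Type u} [Order.Frame L]

instance instSetLike : SetLike (SubPCDLattice L) L where
  coe P := P.carrier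
  coe_injective P Q h := by
    obtain ⟨⟨_, _⟩, _⟩ := P
    obtain ⟨⟨_, _⟩, _⟩ := Q
    congr

/-- A sub-pcd-lattice of a frame is a pcd-lattice, with order and operations those of the frame. -/
instance instPCDLattice (P : SubPCDLattice L) : PCDLattice P where
  toDistribLattice := Sublattice.instDistribLatticeCoe P.toSublattice
  top := ⟨⊤, P.top_mem'⟩
  le_top a := (le_top : (a : L) ≤ ⊤)
  bot := ⟨⊥, P.bot_mem'⟩
  bot_le a := (bot_le : ⊥ ≤ (a : L))
  compl a := ⟨(a : L)ᶜ, P.compl_mem' a.2⟩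
  le_compl_iff a b := by
    rw [Subtype.ext_iff]
    exact (le_compl_iff_disjoint_right (a := (a : L)) (b := (b : L))).trans disjoint_iff

end SubPCDLattice

/-- Membership in the sub-pcd-lattice generated by a subset `S` of a frame. -/
inductive PCDGenerated {L : Type u} [Order.Frame L] (S : Set L) : L → Prop
  | basic {a : L} : a ∈ S → PCDGenerated S a
  | bot : PCDGenerated S ⊥
  | top : PCDGenerated S ⊤
  | inf {a b : L} : PCDGenerated S a → PCDGenerated S b → PCDGenerated S (a ⊓ b)
  | sup {a b : L} : PCDGenerated S a → PCDGenerated S b → PCDGenerated S (a ⊔ b)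
  | compl {a : L} : PCDGenerated S a → PCDGenerated S aᶜ

/-- The sub-pcd-lattice `S*` of a frame generated by a subset `S`. -/
def SubPCDLattice.closure {L : Type u} [Order.Frame L] (S : Set L) : SubPCDLattice L where
  carrier := {a | PCDGenerated S a}
  supClosed' _ ha _ hb := PCDGenerated.sup ha hb
  infClosed' _ ha _ hb := PCDGenerated.inf ha hb
  bot_mem' := PCDGenerated.bot
  top_mem' := PCDGenerated.top
  compl_mem' ha := PCDGenerated.compl ha

/-! ### Strong inclusions and round ideals -/

/-- A strong inclusion on a pcd-lattice. -/
structure IsStrongInclusion {P : Type u} [PCDLattice P] (r : P → P → Prop) : Prop where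
  bot_bot : r ⊥ ⊥
  top_top : r ⊤ ⊤
  mono : ∀ {x a b y : P}, x ≤ a → r a b → b ≤ y → r x y
  inf : ∀ {x a b : P}, r x a → r x b → r x (a ⊓ b)
  sup : ∀ {x y a : P}, r x a → r y a → r (x ⊔ y) a
  compl : ∀ {a b : P}, r a b → r bᶜ aᶜ
  wellInside : ∀ {a b : P}, r a b → WellInside a b
  interpolates : ∀ {x y : P}, r x y → ∃ z, r x z ∧ r z y

/-- The least relation on a pcd-lattice that contains `R` and is closed under the first five
conditions on strong inclusions. -/
inductive GeneratedInclusion {P : Type u} [PCDLattice P] (R : P → P → Prop) : P → P → Prop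
  | base {x y : P} : R x y → GeneratedInclusion R x y
  | bot_bot : GeneratedInclusion R ⊥ ⊥
  | top_top : GeneratedInclusion R ⊤ ⊤
  | mono {x a b y : P} : x ≤ a → GeneratedInclusion R a b → b ≤ y → GeneratedInclusion R x y
  | inf {x a b : P} : GeneratedInclusion R x a → GeneratedInclusion R x b →
      GeneratedInclusion R x (a ⊓ b)
  | sup {x y a : P} : GeneratedInclusion R x a → GeneratedInclusion R y a →
      GeneratedInclusion R (x ⊔ y) a
  | compl {a b : P} : GeneratedInclusion R a b → GeneratedInclusion R bᶜ aᶜ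

/-- The round ideals of a pcd-lattice with a strong inclusion `r`, ordered by inclusion. -/
abbrev RoundIdeal {P : Type u} [PCDLattice P] (r : P → P → Prop) : Type u :=
  {I : Order.Ideal P // ∀ b ∈ I, ∃ a ∈ I, r b a}

/-! ### Locales -/

/-- `B` is a basis of (set-generates) the frame `L`. -/
def IsFrameBasis {L : Type u} [Order.Frame L] (B : Set L) : Prop :=
  ∀ x : L, x = sSup {b | b ∈ B ∧ b ≤ x}

/-- The locale given by a frame with basis `B` is compact. -/
def IsCompactLocale {L : Type u} [Order.Frame L] (B : Set L) : Prop :=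
  ∀ U ⊆ B, sSup U = ⊤ → ∃ F ⊆ U, F.Finite ∧ sSup F = ⊤

/-- The locale given by a frame with basis `B` is regular. -/
def IsRegularLocale {L : Type u} [Order.Frame L] (B : Set L) : Prop :=
  ∀ a ∈ B, a = sSup {b | b ∈ B ∧ WellInside b a}

/-- The locale map `k : L → M` whose inverse image is the frame homomorphism `k : M → L` is a
compact regular compactification of `L`: a dense embedding into the compact regular locale given by
the frame `M` with basis `B`. -/
structure IsCompactification {L : Type u} {M : Type v} [Order.Frame L] [Order.Frame M]
    (B : Set M) (k : FrameHom M L) : Prop where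
  dense : ∀ a : M, k a = ⊥ → a = ⊥
  embedding : Function.Surjective k
  compact : IsCompactLocale B
  regular : IsRegularLocale B

/-- Compatibility with `L` of a strong inclusion `r` on a sub-pcd-lattice `P` of `L`: `L` is
generated by `P`, and each `a ∈ P` is the join in `L` of the `x ∈ P` with `r x a`. -/
def IsCompatible {L : Type u} [Order.Frame L] (P : SubPCDLattice L) (r : P → P → Prop) : Prop :=
  IsFrameBasis (P : Set L) ∧ ∀ a : P, (a : L) = sSup {y | ∃ x : P, r x a ∧ (x : L) = y}

/-! ### The pcd-lattice and the relation determined by a compactification -/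

/-- `P_k`: the sub-pcd-lattice of `L` generated by the image under (the inverse image of) `k` of a
basis `B` and sub-pcd-lattice of `kL`. -/
def compactificationPCD {L : Type u} {M : Type v} [Order.Frame L] [Order.Frame M]
    (k : FrameHom M L) (B : SubPCDLattice M) : SubPCDLattice L :=
  SubPCDLattice.closure (k '' (B : Set M))

/-- The relation `⊲_k` on `P_k`: the least relation containing the pairs `(k b, k a)` for
`a, b ∈ B` with `b` well inside `a`, and closed under the first five conditions on strong
inclusions. -/
def compactificationInclusion {L : Type u} {M : Type v} [Order.Frame L] [Order.Frame M]
    (k : FrameHom M L) (B : SubPCDLattice M) :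
    compactificationPCD k B → compactificationPCD k B → Prop :=
  GeneratedInclusion fun x y =>
    ∃ b ∈ B, ∃ a ∈ B, WellInside b a ∧ (x : L) = k b ∧ (y : L) = k a

/-! ### The well inside relation in a frame -/

section WellInside

variable {M : Type v} [Order.Frame M]

/-! Since `k` is dense and onto, it preserves pseudocomplements (`FrameHom.map_compl_of_dense`), so
the image of `B` is already a sub-pcd-lattice and equals `P_k`. Density also makes `b ≺ a` depend on
`b` only through `k b` (`WellInside.of_map_le`). Hence the generating pairs are already closed under
conditions 1–5, and `⊲_k` is just the image of `≺` (`compactificationInclusion_iff`). Condition 6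
follows by applying `k`; condition 7 is interpolation of `≺`, from compactness and regularity.

The isomorphism sends `I` to the join of all `b ∈ B` with `k b ∈ I`; its inverse sends `m` to the
ideal of all `k b` with `b ≺ m`. Regularity recovers `m`. Compactness and roundness recover `I`: if
`b` is well inside a directed join, it is well inside one of the joined elements. -/

theorem WellInside.le {b a : M} (h : WellInside b a) : b ≤ a := by
  have h' : bᶜ ⊔ a = ⊤ := h
  calc b = b ⊓ (bᶜ ⊔ a) := by rw [h', inf_top_eq]
    _ = b ⊓ a := by rw [inf_sup_left, inf_compl_self, bot_sup_eq]
    _ ≤ a := inf_le_right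

theorem WellInside.mono {x b a y : M} (hx : x ≤ b) (h : WellInside b a) (hy : a ≤ y) :
    WellInside x y := by
  have h' : bᶜ ⊔ a = ⊤ := h
  exact top_unique (h' ▸ sup_le_sup (compl_le_compl hx) hy)

theorem WellInside.inf {x a b : M} (ha : WellInside x a) (hb : WellInside x b) :
    WellInside x (a ⊓ b) := by
  have ha' : xᶜ ⊔ a = ⊤ := ha
  have hb' : xᶜ ⊔ b = ⊤ := hb
  change xᶜ ⊔ a ⊓ b = ⊤
  rw [sup_inf_left, ha', hb', inf_top_eq]

theorem WellInside.sup {x y a : M} (hx : WellInside x a) (hy : WellInside y a) :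
    WellInside (x ⊔ y) a := by
  have hx' : xᶜ ⊔ a = ⊤ := hx
  have hy' : yᶜ ⊔ a = ⊤ := hy
  change (x ⊔ y)ᶜ ⊔ a = ⊤
  rw [compl_sup, sup_inf_right, hx', hy', inf_top_eq]

theorem WellInside.compl {b a : M} (h : WellInside b a) : WellInside aᶜ bᶜ := by
  have h' : bᶜ ⊔ a = ⊤ := h
  refine top_unique (h' ▸ ?_)
  rw [sup_comm]
  exact sup_le_sup le_compl_compl le_rfl

theorem wellInside_bot_left (a : M) : WellInside ⊥ a := by
  change (⊥ : M)ᶜ ⊔ a = ⊤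
  rw [compl_bot, top_sup_eq]

theorem wellInside_top_right (a : M) : WellInside a ⊤ := sup_top_eq _

/-- In a compact locale a cover by an element and a directed family has a two-element subcover. -/
theorem IsCompactLocale.exists_sup_eq_top {B₀ : Set M} (hB₀ : IsFrameBasis B₀)
    (hc : IsCompactLocale B₀) {D : Set M} (hbot : ⊥ ∈ D) (hsup : SupClosed D) {x : M}
    (h : x ⊔ sSup D = ⊤) : ∃ d ∈ D, x ⊔ d = ⊤ := by
  -- Compactness only speaks of covers by basis elements, so the cover is refined to those below
  -- some `x ⊔ d`; `⊥ ∈ D` accounts for `x` itself.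
  have hU : sSup {b | b ∈ B₀ ∧ ∃ d ∈ D, b ≤ x ⊔ d} = ⊤ := by
    have key : ∀ y, (∃ d ∈ D, y ≤ x ⊔ d) → y ≤ sSup {b | b ∈ B₀ ∧ ∃ d ∈ D, b ≤ x ⊔ d} := by
      rintro y ⟨d, hd, hy⟩
      rw [hB₀ y]
      exact sSup_le_sSup fun b hb => ⟨hb.1, d, hd, hb.2.trans hy⟩
    refine top_unique (h ▸ sup_le (key x ⟨⊥, hbot, le_sup_left⟩) (sSup_le fun d hd => ?_))
    exact key d ⟨d, hd, le_sup_right⟩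
  obtain ⟨F, hFU, hF, hFtop⟩ := hc _ (fun b hb => hb.1) hU
  have hfin : ∃ d ∈ D, sSup F ≤ x ⊔ d := by
    -- Covering `⊤` does not pass to subsets of `F`, so it must stay out of the induction.
    clear hFtop
    induction F, hF using Set.Finite.induction_on with
    | empty => exact ⟨⊥, hbot, by simp⟩
    | @insert b F _ _ ih =>
      obtain ⟨d, hd, hle⟩ := ih fun c hc => hFU (Set.mem_insert_of_mem _ hc)
      obtain ⟨-, d', hd', hle'⟩ := hFU (Set.mem_insert b F)
      refine ⟨d ⊔ d', hsup hd hd', ?_⟩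
      rw [sSup_insert]
      exact sup_le (hle'.trans (sup_le_sup le_rfl le_sup_right))
        (hle.trans (sup_le_sup le_rfl le_sup_left))
  obtain ⟨d, hd, hle⟩ := hfin
  exact ⟨d, hd, top_unique (hFtop ▸ hle)⟩

/-- Regularity does not depend on the basis. -/
theorem IsRegularLocale.eq_sSup {B₀ : Set M} (hB₀ : IsFrameBasis B₀) (hr : IsRegularLocale B₀)
    {B : Set M} (hB : IsFrameBasis B) (a : M) : a = sSup {b | b ∈ B ∧ WellInside b a} := by
  refine le_antisymm ?_ (sSup_le fun b hb => hb.2.le)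
  -- Regularity is assumed only at elements of `B₀`, so `a` is first split into these.
  conv_lhs => rw [hB₀ a]
  refine sSup_le fun b₀ hb₀ => ?_
  rw [hr b₀ hb₀.1]
  refine sSup_le fun c hc => ?_
  rw [hB c]
  exact sSup_le_sSup fun b hb => ⟨hb.1, WellInside.mono hb.2 hc.2 hb₀.2⟩

theorem supClosed_wellInside (B : SubPCDLattice M) (a : M) :
    SupClosed {b | b ∈ B ∧ WellInside b a} :=
  fun _ hx _ hy => ⟨B.supClosed' hx.1 hy.1, hx.2.sup hy.2⟩

/-- The well inside relation of a compact regular locale interpolates through any basis that is a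
sub-pcd-lattice. -/
theorem WellInside.exists_between {B₀ : Set M} (hB₀ : IsFrameBasis B₀) (hc : IsCompactLocale B₀)
    (hr : IsRegularLocale B₀) {B : SubPCDLattice M} (hB : IsFrameBasis (B : Set M)) {b a : M}
    (h : WellInside b a) : ∃ c ∈ B, WellInside b c ∧ WellInside c a := by
  have h' : bᶜ ⊔ a = ⊤ := h
  -- Regularity turns `a` into a directed join, from which compactness selects the interpolant.
  rw [hr.eq_sSup hB₀ hB a] at h'
  obtain ⟨c, hcB, hc⟩ := hc.exists_sup_eq_top hB₀ (D := {b | b ∈ B ∧ WellInside b a})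
    ⟨B.bot_mem', wellInside_bot_left a⟩ (supClosed_wellInside B a) h'
  exact ⟨c, hcB.1, hc, hcB.2⟩

end WellInside

/-! ### Generated sub-pcd-lattices -/

theorem IsFrameBasis.mono {M : Type v} [Order.Frame M] {B C : Set M} (hB : IsFrameBasis B)
    (h : B ⊆ C) : IsFrameBasis C := by
  refine fun x => le_antisymm ?_ (sSup_le fun b hb => hb.2)
  conv_lhs => rw [hB x]
  exact sSup_le_sSup fun b hb => ⟨h hb.1, hb.2⟩

/-- Terms of the language of pcd-lattices with variables in `α`. -/
inductive PCDTerm (α : Type w) : Type w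
  | var : α → PCDTerm α
  | bot : PCDTerm α
  | top : PCDTerm α
  | inf : PCDTerm α → PCDTerm α → PCDTerm α
  | sup : PCDTerm α → PCDTerm α → PCDTerm α
  | compl : PCDTerm α → PCDTerm α

/-- The value of a term in a frame. -/
def PCDTerm.eval {M : Type v} [Order.Frame M] {α : Type w} (f : α → M) : PCDTerm α → M
  | var a => f a
  | bot => ⊥
  | top => ⊤
  | inf s t => s.eval f ⊓ t.eval f
  | sup s t => s.eval f ⊔ t.eval f
  | compl t => (t.eval f)ᶜ

theorem PCDGenerated.exists_eval {M : Type v} [Order.Frame M] {S : Set M} {α : Type w} {f : α → M}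
    (hf : S ⊆ Set.range f) {a : M} (h : PCDGenerated S a) : ∃ t : PCDTerm α, t.eval f = a := by
  induction h with
  | basic h => exact (hf h).imp' PCDTerm.var fun _ h => h
  | bot => exact ⟨.bot, rfl⟩
  | top => exact ⟨.top, rfl⟩
  | inf _ _ ihs iht =>
    obtain ⟨⟨s, rfl⟩, ⟨t, rfl⟩⟩ := And.intro ihs iht
    exact ⟨.inf s t, rfl⟩
  | sup _ _ ihs iht =>
    obtain ⟨⟨s, rfl⟩, ⟨t, rfl⟩⟩ := And.intro ihs iht
    exact ⟨.sup s t, rfl⟩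
  | compl _ ih =>
    obtain ⟨t, rfl⟩ := ih
    exact ⟨.compl t, rfl⟩

/-- Terms with variables in `Shrink S` form a type in universe `w`, and their values exhaust the
closure. -/
theorem SubPCDLattice.small_closure {M : Type v} [Order.Frame M] (S : Set M) [Small.{w} S] :
    Small.{w} (SubPCDLattice.closure S) := by
  let f : Shrink.{w} S → M := fun a => ((equivShrink S).symm a : M)
  have hf : S ⊆ Set.range f := fun a ha => ⟨equivShrink S ⟨a, ha⟩, by simp [f]⟩
  have : Small.{w} (Set.range (PCDTerm.eval f)) := small_range _
  exact small_subset (s := Set.range (PCDTerm.eval f)) (t := {a | PCDGenerated S a}) fun a ha => PCDGenerated.exists_eval hf ha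

/-! ### Dense embeddings -/

section Dense

variable {L : Type u} {M : Type v} [Order.Frame L] [Order.Frame M] {k : FrameHom M L}

/-- A dense embedding preserves pseudocomplements. -/
theorem FrameHom.map_compl_of_dense (hd : ∀ a, k a = ⊥ → a = ⊥) (hs : Function.Surjective k)
    (m : M) : k mᶜ = (k m)ᶜ := by
  apply le_antisymm
  · rw [le_compl_iff_disjoint_right, disjoint_iff, ← map_inf, compl_inf_self, map_bot]
  -- A preimage `n` of `(k m)ᶜ` has `k (n ⊓ m) = ⊥`, so density gives `n ≤ mᶜ`.
  · obtain ⟨n, hn⟩ := hs (k m)ᶜ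
    rw [← hn]
    apply OrderHomClass.mono k
    rw [le_compl_iff_disjoint_right, disjoint_iff]
    apply hd
    rw [map_inf, hn, compl_inf_self]

/-- `k` need not reflect order, but it sends `cᶜ ⊓ b` below `k (cᶜ ⊓ c) = ⊥`, so density kills this
meet. -/
theorem FrameHom.compl_le_compl_of_dense (hd : ∀ a, k a = ⊥ → a = ⊥) {b c : M} (h : k b ≤ k c) :
    cᶜ ≤ bᶜ := by
  rw [le_compl_iff_disjoint_right, disjoint_iff]
  apply hd
  rw [map_inf]
  refine bot_unique ((inf_le_inf le_rfl h).trans ?_)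
  rw [← map_inf, compl_inf_self, map_bot]

theorem WellInside.of_map_le (hd : ∀ a, k a = ⊥ → a = ⊥) {b c a : M} (h : k b ≤ k c)
    (hc : WellInside c a) : WellInside b a := by
  have hc' : cᶜ ⊔ a = ⊤ := hc
  exact top_unique (hc' ▸ sup_le_sup (FrameHom.compl_le_compl_of_dense hd h) le_rfl)

theorem mem_compactificationPCD_iff (hd : ∀ a, k a = ⊥ → a = ⊥) (hs : Function.Surjective k)
    {B : SubPCDLattice M} {x : L} : x ∈ compactificationPCD k B ↔ ∃ b ∈ B, k b = x := by
  refine ⟨fun h => ?_, fun ⟨b, hb, h⟩ => PCDGenerated.basic ⟨b, hb, h⟩⟩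
  change PCDGenerated _ x at h
  induction h with
  | basic h => exact h
  | bot => exact ⟨⊥, B.bot_mem', map_bot k⟩
  | top => exact ⟨⊤, B.top_mem', map_top k⟩
  | inf _ _ iha ihb =>
    obtain ⟨⟨a, ha, rfl⟩, ⟨b, hb, rfl⟩⟩ := And.intro iha ihb
    exact ⟨a ⊓ b, B.infClosed' ha hb, map_inf k a b⟩
  | sup _ _ iha ihb =>
    obtain ⟨⟨a, ha, rfl⟩, ⟨b, hb, rfl⟩⟩ := And.intro iha ihb
    exact ⟨a ⊔ b, B.supClosed' ha hb, map_sup k a b⟩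
  | compl _ ih =>
    obtain ⟨a, ha, rfl⟩ := ih
    exact ⟨aᶜ, B.compl_mem' ha, FrameHom.map_compl_of_dense hd hs a⟩

/-- For a dense embedding the generating pairs are already closed under the first five conditions
on strong inclusions. -/
theorem compactificationInclusion_iff (hd : ∀ a, k a = ⊥ → a = ⊥) (hs : Function.Surjective k)
    {B : SubPCDLattice M} {x y : compactificationPCD k B} :
    compactificationInclusion k B x y ↔
      ∃ b ∈ B, ∃ a ∈ B, WellInside b a ∧ (x : L) = k b ∧ (y : L) = k a := by
  refine ⟨fun h => ?_, fun h => .base h⟩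
  unfold compactificationInclusion at h
  induction h with
  | base h => exact h
  | bot_bot =>
    exact ⟨⊥, B.bot_mem', ⊥, B.bot_mem', wellInside_bot_left _, (map_bot k).symm, (map_bot k).symm⟩
  | top_top =>
    exact ⟨⊤, B.top_mem', ⊤, B.top_mem', wellInside_top_right _, (map_top k).symm, (map_top k).symm⟩
  | @mono x _ _ y hx _ hy ih =>
    obtain ⟨b, hb, a, ha, hba, h₁, h₂⟩ := ih
    obtain ⟨b', hb', hxb⟩ := (mem_compactificationPCD_iff hd hs).1 x.2
    obtain ⟨a', ha', hya⟩ := (mem_compactificationPCD_iff hd hs).1 y.2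
    -- The inequalities hold only after applying `k`; meeting with `b` and joining with `a` makes
    -- them hold in `M` without changing the images.
    refine ⟨b' ⊓ b, B.infClosed' hb' hb, a' ⊔ a, B.supClosed' ha' ha,
      WellInside.mono inf_le_right hba le_sup_right, ?_, ?_⟩
    · rw [map_inf, hxb, ← h₁]
      exact (inf_eq_left (α := L).2 hx).symm
    · rw [map_sup, hya, ← h₂]
      exact (sup_eq_left (α := L).2 hy).symm
  | @inf x a₁ a₂ _ _ ih₁ ih₂ =>
    obtain ⟨b, hb, a, ha, hba, h₁, h₂⟩ := ih₁
    obtain ⟨b', hb', a', ha', hba', h₁', h₂'⟩ := ih₂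
    -- `b` and `b'` both represent `x`; so does their meet, which is well inside both right-hand
    -- sides.
    refine ⟨b ⊓ b', B.infClosed' hb hb', a ⊓ a', B.infClosed' ha ha',
      (hba.mono inf_le_left le_rfl).inf (hba'.mono inf_le_right le_rfl), ?_, ?_⟩
    · rw [map_inf, ← h₁, ← h₁', inf_idem]
    · rw [map_inf, ← h₂, ← h₂']
      rfl
  | @sup x₁ x₂ a _ _ ih₁ ih₂ =>
    obtain ⟨b, hb, a, ha, hba, h₁, h₂⟩ := ih₁
    obtain ⟨b', hb', a', ha', hba', h₁', h₂'⟩ := ih₂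
    refine ⟨b ⊔ b', B.supClosed' hb hb', a ⊔ a', B.supClosed' ha ha',
      (hba.mono le_rfl le_sup_left).sup (hba'.mono le_rfl le_sup_right), ?_, ?_⟩
    · rw [map_sup, ← h₁, ← h₁']
      rfl
    · rw [map_sup, ← h₂, ← h₂', sup_idem]
  | compl _ ih =>
    obtain ⟨b, hb, a, ha, hba, h₁, h₂⟩ := ih
    refine ⟨aᶜ, B.compl_mem' ha, bᶜ, B.compl_mem' hb, hba.compl, ?_, ?_⟩
    · rw [FrameHom.map_compl_of_dense hd hs, ← h₂]
      rfl
    · rw [FrameHom.map_compl_of_dense hd hs, ← h₁]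
      rfl

theorem FrameHom.map_eq_sSup_image (k : FrameHom M L) {S : Set M} {m : M} (h : m = sSup S) :
    k m = sSup (k '' S) := by
  rw [h, map_sSup]

end Dense

/-! ### The strong inclusion of a compactification -/

namespace IsCompactification

variable {L : Type u} {M : Type v} [Order.Frame L] [Order.Frame M] {B₀ : Set M}
  {k : FrameHom M L} {B : SubPCDLattice M}

theorem isStrongInclusion (hB₀ : IsFrameBasis B₀) (hk : IsCompactification B₀ k)
    (hB : IsFrameBasis (B : Set M)) : IsStrongInclusion (compactificationInclusion k B) where
  bot_bot := .bot_bot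
  top_top := .top_top
  mono := .mono
  inf := .inf
  sup := .sup
  compl := .compl
  wellInside {x y} h := by
    obtain ⟨b, -, a, -, hba, h₁, h₂⟩ := (compactificationInclusion_iff hk.dense hk.embedding).1 h
    have hba' : bᶜ ⊔ a = ⊤ := hba
    apply Subtype.ext
    change (x : L)ᶜ ⊔ (y : L) = ⊤
    rw [h₁, h₂, ← FrameHom.map_compl_of_dense hk.dense hk.embedding, ← map_sup, hba', map_top]
  interpolates {x y} h := by
    obtain ⟨b, hb, a, ha, hba, h₁, h₂⟩ := (compactificationInclusion_iff hk.dense hk.embedding).1 h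
    obtain ⟨c, hc, hbc, hca⟩ := hba.exists_between hB₀ hk.compact hk.regular hB
    exact ⟨⟨k c, .basic ⟨c, hc, rfl⟩⟩, .base ⟨b, hb, c, hc, hbc, h₁, rfl⟩,
      .base ⟨c, hc, a, ha, hca, rfl, h₂⟩⟩

/-- Both joins are images under `k` of joins in `M`: the expansion in the basis `B`, and regularity.
-/
theorem isCompatible (hB₀ : IsFrameBasis B₀) (hk : IsCompactification B₀ k)
    (hB : IsFrameBasis (B : Set M)) :
    IsCompatible (compactificationPCD k B) (compactificationInclusion k B) := by
  refine ⟨fun x => le_antisymm ?_ (sSup_le fun _ h => h.2), fun x => le_antisymm ?_ ?_⟩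
  · obtain ⟨m, rfl⟩ := hk.embedding x
    conv_lhs => rw [k.map_eq_sSup_image (hB m)]
    apply sSup_le_sSup
    rintro _ ⟨b, hb, rfl⟩
    exact ⟨.basic ⟨b, hb.1, rfl⟩, OrderHomClass.mono k hb.2⟩
  · obtain ⟨a, ha, hxa⟩ := (mem_compactificationPCD_iff hk.dense hk.embedding).1 x.2
    conv_lhs => rw [← hxa, k.map_eq_sSup_image (hk.regular.eq_sSup hB₀ hB a)]
    apply sSup_le_sSup
    rintro _ ⟨b, hb, rfl⟩
    exact ⟨⟨k b, .basic ⟨b, hb.1, rfl⟩⟩, .base ⟨b, hb.1, a, ha, hb.2, rfl, hxa.symm⟩, rfl⟩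
  · apply sSup_le
    rintro _ ⟨z, hz, rfl⟩
    obtain ⟨b, -, a, -, hba, h₁, h₂⟩ := (compactificationInclusion_iff hk.dense hk.embedding).1 hz
    rw [h₁, h₂]
    exact OrderHomClass.mono k hba.le

/-! ### Round ideals and elements of `kL` -/

/-- The elements of the basis `B` whose restriction to `L` lies in a given ideal. -/
def basisPreimage (k : FrameHom M L) (B : SubPCDLattice M)
    (I : Order.Ideal (compactificationPCD k B)) : Set M :=
  {b | ∃ hb : b ∈ B, (⟨k b, .basic ⟨b, hb, rfl⟩⟩ : compactificationPCD k B) ∈ I}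

theorem bot_mem_basisPreimage (I : Order.Ideal (compactificationPCD k B)) :
    ⊥ ∈ basisPreimage k B I := by
  obtain ⟨x, hx⟩ := I.nonempty
  refine ⟨B.bot_mem', I.lower ?_ hx⟩
  change k ⊥ ≤ (x : L)
  rw [map_bot]
  exact bot_le

theorem supClosed_basisPreimage (I : Order.Ideal (compactificationPCD k B)) :
    SupClosed (basisPreimage k B I) := by
  rintro a ⟨ha, haI⟩ b ⟨hb, hbI⟩
  refine ⟨B.supClosed' ha hb, I.lower ?_ (Order.Ideal.sup_mem haI hbI)⟩
  change k (a ⊔ b) ≤ k a ⊔ k b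
  rw [map_sup]

/-- The element of `kL` determined by a round ideal. -/
def ofRoundIdeal (k : FrameHom M L) (B : SubPCDLattice M)
    (I : RoundIdeal (compactificationInclusion k B)) : M :=
  sSup (basisPreimage k B I.1)

theorem ofRoundIdeal_mono : Monotone (ofRoundIdeal k B) :=
  fun _ _ h => sSup_le_sSup fun _ hb => ⟨hb.1, h hb.2⟩

theorem map_ofRoundIdeal (hk : IsCompactification B₀ k)
    (I : RoundIdeal (compactificationInclusion k B)) :
    k (ofRoundIdeal k B I) = sSup {y | ∃ x : compactificationPCD k B, x ∈ I.1 ∧ (x : L) = y} := by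
  rw [k.map_eq_sSup_image (m := ofRoundIdeal k B I) rfl]
  congr 1
  ext y
  constructor
  · rintro ⟨b, hb, rfl⟩
    exact ⟨_, hb.2, rfl⟩
  · rintro ⟨⟨x, hxP⟩, hx, rfl⟩
    obtain ⟨b, hb, rfl⟩ := (mem_compactificationPCD_iff hk.dense hk.embedding).1 hxP
    exact ⟨b, ⟨hb, hx⟩, rfl⟩

/-- The round ideal of elements well inside a given element of `kL`. -/
def toRoundIdeal (hB₀ : IsFrameBasis B₀) (hk : IsCompactification B₀ k)
    (hB : IsFrameBasis (B : Set M)) (m : M) : RoundIdeal (compactificationInclusion k B) where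
  val :=
    { carrier := {x | ∃ b ∈ B, WellInside b m ∧ (x : L) = k b}
      lower' := by
        rintro x y hyx ⟨b, hb, hbm, h⟩
        obtain ⟨c, hc, hyc⟩ := (mem_compactificationPCD_iff hk.dense hk.embedding).1 y.2
        -- Only `k c ≤ k b` is known, not `c ≤ b`; density suffices.
        refine ⟨c, hc, hbm.of_map_le hk.dense ?_, hyc.symm⟩
        rw [hyc, ← h]
        exact hyx
      nonempty' := ⟨⊥, ⊥, B.bot_mem', wellInside_bot_left m, (map_bot k).symm⟩
      directed' := by
        rintro x ⟨b, hb, hbm, h⟩ y ⟨c, hc, hcm, h'⟩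
        refine ⟨x ⊔ y, ⟨b ⊔ c, B.supClosed' hb hc, hbm.sup hcm, ?_⟩, le_sup_left, le_sup_right⟩
        rw [map_sup, ← h, ← h']
        rfl }
  property := by
    rintro x ⟨b, hb, hbm, h⟩
    obtain ⟨c, hc, hbc, hcm⟩ := hbm.exists_between hB₀ hk.compact hk.regular hB
    exact ⟨⟨k c, .basic ⟨c, hc, rfl⟩⟩, ⟨c, hc, hcm, rfl⟩, .base ⟨b, hb, c, hc, hbc, h, rfl⟩⟩

theorem mem_toRoundIdeal (hB₀ : IsFrameBasis B₀) (hk : IsCompactification B₀ k)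
    (hB : IsFrameBasis (B : Set M)) {m : M} {x : compactificationPCD k B} :
    x ∈ (toRoundIdeal hB₀ hk hB m).1 ↔ ∃ b ∈ B, WellInside b m ∧ (x : L) = k b :=
  Iff.rfl

theorem toRoundIdeal_mono (hB₀ : IsFrameBasis B₀) (hk : IsCompactification B₀ k)
    (hB : IsFrameBasis (B : Set M)) : Monotone (toRoundIdeal hB₀ hk hB) :=
  fun _ _ h _ ⟨b, hb, hbm, hx⟩ => ⟨b, hb, hbm.mono le_rfl h, hx⟩

theorem ofRoundIdeal_toRoundIdeal (hB₀ : IsFrameBasis B₀) (hk : IsCompactification B₀ k)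
    (hB : IsFrameBasis (B : Set M)) (m : M) : ofRoundIdeal k B (toRoundIdeal hB₀ hk hB m) = m := by
  apply le_antisymm
  · apply sSup_le
    rintro b ⟨hb, c, hc, hcm, h⟩
    exact (hcm.of_map_le hk.dense (le_of_eq h)).le
  · conv_lhs => rw [hk.regular.eq_sSup hB₀ hB m]
    exact sSup_le_sSup fun b hb => ⟨hb.1, b, hb.1, hb.2, rfl⟩

theorem toRoundIdeal_ofRoundIdeal (hB₀ : IsFrameBasis B₀) (hk : IsCompactification B₀ k)
    (hB : IsFrameBasis (B : Set M)) (I : RoundIdeal (compactificationInclusion k B)) :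
    toRoundIdeal hB₀ hk hB (ofRoundIdeal k B I) = I := by
  apply Subtype.ext
  ext x
  refine (mem_toRoundIdeal hB₀ hk hB).trans ⟨?_, fun hx => ?_⟩
  · rintro ⟨b, hb, hbI, hx⟩
    -- `hbI` unfolds to a cover of `⊤` by `bᶜ` and a directed family, so one member `c` already has
    -- `b ≺ c`.
    obtain ⟨c, ⟨hc, hcI⟩, hbc⟩ := hk.compact.exists_sup_eq_top hB₀
      (bot_mem_basisPreimage I.1) (supClosed_basisPreimage I.1) hbI
    refine I.1.lower ?_ hcI
    change (x : L) ≤ k c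
    rw [hx]
    exact OrderHomClass.mono k (WellInside.le hbc)
  -- Roundness supplies `k a ∈ I` with `x = k b` and `b ≺ a`, and `a` lies below the join.
  · obtain ⟨⟨y, hyP⟩, hy, hxy⟩ := I.2 x hx
    obtain ⟨b, hb, a, ha, hba, h₁, rfl⟩ :=
      (compactificationInclusion_iff hk.dense hk.embedding).1 hxy
    exact ⟨b, hb, hba.mono le_rfl (le_sSup ⟨ha, hy⟩), h₁⟩

/-- The round ideals of the strong inclusion of a compactification form the frame `kL`. -/
def roundIdealEquiv (hB₀ : IsFrameBasis B₀) (hk : IsCompactification B₀ k)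
    (hB : IsFrameBasis (B : Set M)) : RoundIdeal (compactificationInclusion k B) ≃o M :=
  Equiv.toOrderIso
    { toFun := ofRoundIdeal k B
      invFun := toRoundIdeal hB₀ hk hB
      left_inv := toRoundIdeal_ofRoundIdeal hB₀ hk hB
      right_inv := ofRoundIdeal_toRoundIdeal hB₀ hk hB }
    ofRoundIdeal_mono (toRoundIdeal_mono hB₀ hk hB)

end IsCompactification

theorem mainTheorem3 {L : Type u} {M : Type v} [Order.Frame L] [Order.Frame M]
    (B₀ : Set M) [Small.{w} B₀] (hB₀ : IsFrameBasis B₀)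
    (k : FrameHom M L) (hk : IsCompactification B₀ k) :
    (∃ B : SubPCDLattice M, Small.{w} B ∧ IsFrameBasis (B : Set M)) ∧
    ∀ B : SubPCDLattice M, Small.{w} B → IsFrameBasis (B : Set M) →
      Small.{w} (compactificationPCD k B) ∧
      IsStrongInclusion (compactificationInclusion k B) ∧
      IsCompatible (compactificationPCD k B) (compactificationInclusion k B) ∧
      ∃ e : RoundIdeal (compactificationInclusion k B) ≃o M,
        ∀ I : RoundIdeal (compactificationInclusion k B),
          k (e I) = sSup {y | ∃ x : compactificationPCD k B, x ∈ I.1 ∧ (x : L) = y} := by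
  refine ⟨⟨.closure B₀, SubPCDLattice.small_closure B₀, hB₀.mono fun _ h => .basic h⟩,
    fun B hsmall hB => ⟨?_, hk.isStrongInclusion hB₀ hB, hk.isCompatible hB₀ hB,
      hk.roundIdealEquiv hB₀ hB, hk.map_ofRoundIdeal⟩⟩
  have : Small.{w} (B : Set M) := hsmall
  have : Small.{w} (k '' (B : Set M)) := small_image _ _
  exact SubPCDLattice.small_closure _
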